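/- A periodic point set in $\mathbb R^n$ is a set $S=M+\Lambda$, where $\Lambda$ is the lattice of all integer combinations of a basis $v_1,\dots,v_n$ of $\mathbb R^n$ and the motif $M$ is a finite non-empty subset of the unit cell $\{\sum_i x_iv_i : x_i\in[0,1)\}$. **Distances and radii.** The bottleneck distance is $\mathrm{BD}(S,Q)=\inf_{g}\sup_{p\in S}|g(p)-p|$ over all bijections $g:S\to Q$, with value $+\infty$ allowed. The packing radius $r(Q)$ is the minimum half-distance between distinct points of $Q$. **Isosets.** For $p\in S$ and $\alpha\ge 0$, the cluster $C(S,p;\alpha)$ is the set of all vectors $q-p$ with $q\in S$ and $|q-p|\le\alpha$; for $\alpha<0$ it is empty. Two clusters are isometric if an isometry of $\mathbb R^n$ fixing $0$ maps one onto the other. The isoset $I(S;\alpha)$ is the finite set of isometry classes $\sigma$ of the clusters $C(S,p;\alpha)$, $p\in M$, where $\sigma$ has weight $k/|M|$ if exactly $k$ points $p\in M$ have $C(S,p;\alpha)\in\sigma$. **Boundary tolerant metric.** If $\sigma,\xi$ are the classes of $C(S,p;\alpha)$ and $C(Q,q;\alpha)$, then $\mathrm{BT}(\sigma,\xi)$ is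 the infimum of all $\varepsilon\ge0$ such that $$C(Q,q;\alpha-\varepsilon)\subseteq f(C(S,p;\alpha))+\bar B(0;\varepsilon)\quad\text{and}\quad C(S,p;\alpha-\varepsilon)\subseteq g(C(Q,q;\alpha))+\bar B(0;\varepsilon)$$ for some isometries $f,g$ of $\mathbb R^n$ fixing $0$. **Earth Mover's Distance.** For $I(S;\alpha)=\{(\sigma_i,w_i)\}$ and $I(Q;\alpha)=\{(\xi_j,v_j)\}$, the distance $\mathrm{EMD}(I(S;\alpha),I(Q;\alpha))$ is the infimum of $\sum_{i,j}f_{ij}\,\mathrm{BT}(\sigma_i,\xi_j)$ over all flows $f_{ij}\in[0,1]$ with $\sum_jf_{ij}\le w_i$ for every $i$, $\sum_if_{ij}\le v_j$ for every $j$, and $\sum_{i,j}f_{ij}=1$. **Theorem.** Let $S,Q\subset\mathbb R^n$ be periodic point sets with $\mathrm{BD}(S,Q)<r(Q)$. Then, for every $\alpha\ge0$, $$\mathrm{EMD}(I(S;\alpha),I(Q;\alpha))\le 2\,\mathrm{BD}(S,Q).$$ -/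

import Mathlib

open scoped NNReal ENNReal Pointwise

noncomputable section

/-- Euclidean space `ℝⁿ` with the Euclidean norm. -/
abbrev Euc (n : ℕ) : Type := EuclideanSpace ℝ (Fin n)

/-- Data of a periodic point set in `ℝⁿ`: a basis of `ℝⁿ` and a finite non-empty motif contained
in the half-open unit cell `{∑ xᵢ vᵢ | 0 ≤ xᵢ < 1}` of this basis. -/
structure PeriodicPointSet (n : ℕ) where
  basis : Module.Basis (Fin n) ℝ (Euc n)
  motif : Finset (Euc n)
  motif_nonempty : motif.Nonempty
  motif_subset : (motif : Set (Euc n)) ⊆ ZSpan.fundamentalDomain basis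

/-- The lattice of all integer combinations of the basis vectors. -/
def PeriodicPointSet.lattice {n : ℕ} (S : PeriodicPointSet n) : Set (Euc n) :=
  (Submodule.span ℤ (Set.range S.basis) : Submodule ℤ (Euc n))

/-- The underlying set of points, the Minkowski sum of the motif and the lattice. -/
def PeriodicPointSet.points {n : ℕ} (S : PeriodicPointSet n) : Set (Euc n) :=
  (S.motif : Set (Euc n)) + S.lattice

/-- The bottleneck distance: infimum over all bijections `g : A → B` of `sup_p |g(p) - p|`.
It is `∞` when there are no bijections. -/
def bottleneckDist {X : Type*} [PseudoEMetricSpace X] (A B : Set X) : ℝ≥0∞ :=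
  ⨅ g : A ≃ B, ⨆ p : A, edist ((g p : B) : X) (p : X)

/-- The packing radius: the minimum half-distance between distinct points. -/
def packingRadius {X : Type*} [PseudoEMetricSpace X] (A : Set X) : ℝ≥0∞ :=
  A.einfsep / 2

/-- The local cluster `C(A, p; r)`: all vectors `q - p` with `q ∈ A` and `|q - p| ≤ r`. -/
def localCluster {n : ℕ} (A : Set (Euc n)) (p : Euc n) (r : ℝ) : Set (Euc n) :=
  {v | ∃ q ∈ A, v = q - p ∧ ‖q - p‖ ≤ r}

/-- Two sets of vectors (clusters centred at `0`) are isometric if an isometry of `ℝⁿ` that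
fixes the centre maps one onto the other. -/
def ClusterIsometric {n : ℕ} (C D : Set (Euc n)) : Prop :=
  ∃ f : Euc n ≃ᵢ Euc n, f 0 = 0 ∧ f '' C = D

theorem clusterIsometric_symm {n : ℕ} {C D : Set (Euc n)} (h : ClusterIsometric C D) :
    ClusterIsometric D C := by
  obtain ⟨f, hf, rfl⟩ := h
  exact ⟨f.symm, by rw [IsometryEquiv.symm_apply_eq, hf], f.toEquiv.symm_image_image C⟩

theorem clusterIsometric_trans {n : ℕ} {C D F : Set (Euc n)} (h : ClusterIsometric C D)
    (h' : ClusterIsometric D F) : ClusterIsometric C F := by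
  obtain ⟨f, hf, rfl⟩ := h
  obtain ⟨g, hg, rfl⟩ := h'
  exact ⟨f.trans g, (congrArg g hf).trans hg, (Set.image_image g f C).symm⟩

def clusterSetoid (n : ℕ) : Setoid (Set (Euc n)) where
  r := ClusterIsometric
  iseqv := ⟨fun C => ⟨IsometryEquiv.refl _, rfl, Set.image_id C⟩, clusterIsometric_symm,
    clusterIsometric_trans⟩

/-- Isometry classes of clusters. -/
def ClusterClass (n : ℕ) : Type := Quotient (clusterSetoid n)

/-- The isometry class of a cluster. -/
def ClusterClass.mk {n : ℕ} (C : Set (Euc n)) : ClusterClass n :=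
  Quotient.mk (clusterSetoid n) C

/-- The part of a cluster within the radius `r` of its centre `0`. -/
def truncateCluster {n : ℕ} (C : Set (Euc n)) (r : ℝ) : Set (Euc n) :=
  {v ∈ C | ‖v‖ ≤ r}

/-- Truncating an `α`-cluster at a radius `α - ε` gives the `(α - ε)`-cluster. -/
theorem truncateCluster_localCluster {n : ℕ} (A : Set (Euc n)) (p : Euc n) (α : ℝ) (ε : ℝ≥0) :
    truncateCluster (localCluster A p α) (α - ε) = localCluster A p (α - ε) := by
  ext v
  constructor
  · rintro ⟨⟨q, hq, rfl, -⟩, h⟩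
    exact ⟨q, hq, rfl, h⟩
  · rintro ⟨q, hq, rfl, h⟩
    exact ⟨⟨q, hq, rfl, h.trans (sub_le_self _ ε.coe_nonneg)⟩, h⟩

/-- For `α`-clusters `C` and `D`, the part of `D` within the radius `α - ε` is covered by the
`ε`-offset of an image of `C` under an isometry that preserves the centre. -/
def CoversUpTo {n : ℕ} (α : ℝ) (C D : Set (Euc n)) (ε : ℝ≥0) : Prop :=
  ∃ f : Euc n ≃ᵢ Euc n, f 0 = 0 ∧
    truncateCluster D (α - ε) ⊆ f '' C + Metric.closedBall (0 : Euc n) ε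

/-- The boundary tolerant distance of two `α`-clusters: the infimum of all `ε ≥ 0` such that each
cluster, cut at the radius `α - ε`, is covered by the `ε`-offset of an isometric image of the
other one. -/
def clusterBT {n : ℕ} (α : ℝ) (C D : Set (Euc n)) : ℝ≥0∞ :=
  ⨅ (ε : ℝ≥0) (_ : CoversUpTo α C D ε ∧ CoversUpTo α D C ε), (ε : ℝ≥0∞)

theorem norm_map_of_fix {n : ℕ} (f : Euc n ≃ᵢ Euc n) (hf : f 0 = 0) (v : Euc n) :
    ‖f v‖ = ‖v‖ := by
  have h := f.dist_eq v 0
  rwa [hf, dist_zero_right, dist_zero_right] at h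

theorem coversUpTo_of_isometric {n : ℕ} {α : ℝ} {C C' D D' : Set (Euc n)} {ε : ℝ≥0}
    (hC : ClusterIsometric C C') (hD : ClusterIsometric D D') (h : CoversUpTo α C D ε) :
    CoversUpTo α C' D' ε := by
  obtain ⟨a, ha, rfl⟩ := hC
  obtain ⟨b, hb, rfl⟩ := hD
  obtain ⟨f, hf, h⟩ := h
  refine ⟨a.symm.trans (f.trans b), ?_, ?_⟩
  · have : a.symm 0 = 0 := by rw [IsometryEquiv.symm_apply_eq, ha]
    simp [this, hf, hb]
  · rintro _ ⟨⟨v, hv, rfl⟩, hn⟩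
    rw [norm_map_of_fix b hb] at hn
    obtain ⟨_, ⟨c, hc, rfl⟩, w, hw, hs⟩ := h ⟨hv, hn⟩
    refine ⟨b (f c), ⟨a c, ⟨c, hc, rfl⟩, by simp⟩, b v - b (f c), ?_, by simp⟩
    rw [mem_closedBall_zero_iff] at hw ⊢
    rw [← dist_eq_norm, b.dist_eq, dist_eq_norm, ← hs]
    simpa using hw

/-- The boundary tolerant metric `BT` on isometry classes of `α`-clusters; it does not depend on
the representatives. -/
def boundaryTolerant {n : ℕ} (α : ℝ) (σ ξ : ClusterClass n) : ℝ≥0∞ :=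
  Quotient.liftOn₂ σ ξ (clusterBT α) (by
    intro C D C' D' hC hD
    have key : ∀ ε : ℝ≥0, (CoversUpTo α C D ε ∧ CoversUpTo α D C ε) ↔
        (CoversUpTo α C' D' ε ∧ CoversUpTo α D' C' ε) := fun ε =>
      ⟨fun h => ⟨coversUpTo_of_isometric hC hD h.1, coversUpTo_of_isometric hD hC h.2⟩,
       fun h => ⟨coversUpTo_of_isometric (clusterIsometric_symm hC) (clusterIsometric_symm hD) h.1,
        coversUpTo_of_isometric (clusterIsometric_symm hD) (clusterIsometric_symm hC) h.2⟩⟩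
    simp only [clusterBT, key])

open Classical in
/-- The isoset `I(S; α)`, as a finitely supported weight on isometry classes of clusters: the weight
of a class is `k / m`, where `k` is the number of those motif points whose `α`-cluster is in this
class and `m` is the number of all motif points. -/
def PeriodicPointSet.isoset {n : ℕ} (S : PeriodicPointSet n) (α : ℝ) : ClusterClass n →₀ ℝ≥0 :=
  Finsupp.onFinset (S.motif.image fun p => ClusterClass.mk (localCluster S.points p α))
    (fun σ => ((S.motif.filter fun p => ClusterClass.mk (localCluster S.points p α) = σ).card : ℝ≥0)
      / (S.motif.card : ℝ≥0))
    (by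
      intro σ hσ
      have h : (S.motif.filter
          fun p => ClusterClass.mk (localCluster S.points p α) = σ).card ≠ 0 := by
        intro h0
        exact hσ (by simp only [h0, Nat.cast_zero, zero_div])
      obtain ⟨p, hp⟩ := Finset.card_ne_zero.mp h
      rw [Finset.mem_filter] at hp
      exact Finset.mem_image.mpr ⟨p, hp.1, hp.2⟩)

/-- A flow between weighted distributions `w` and `v` (the objects are the points of the supports):
entries in `[0, 1]`, row sums at most `w`, column sums at most `v`, total sum `1`. -/
structure IsFlow {X Y : Type*} (w : X →₀ ℝ≥0) (v : Y →₀ ℝ≥0)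
    (f : w.support → v.support → ℝ≥0) : Prop where
  le_one : ∀ i j, f i j ≤ 1
  row_le : ∀ i, ∑ j, f i j ≤ w i
  col_le : ∀ j, ∑ i, f i j ≤ v j
  total : ∑ i, ∑ j, f i j = 1

/-- The Earth Mover's Distance between weighted distributions for a ground distance `d`. -/
def earthMoverDist {X Y : Type*} (d : X → Y → ℝ≥0∞) (w : X →₀ ℝ≥0) (v : Y →₀ ℝ≥0) : ℝ≥0∞ :=
  ⨅ (f : w.support → v.support → ℝ≥0) (_ : IsFlow w v f),
    ∑ i, ∑ j, (f i j : ℝ≥0∞) * d (i : X) (j : Y)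

end

/-! Take a bijection `g` moving points by at most `δ < r(Q)`; distinct points of `Q` are then more
than `2δ + η` apart for some `η > 0`. This rigidity forces common periods. If a period `w` of `S` is
within `η` of a period `l` of `Q`, then `g` turns each shift by `w` into a shift by `l`, and bounded
displacement along `m + j • w` gives `w = l` (`eq_of_near_lattice`). Every period of `S` has a
positive multiple that close to the lattice of `Q`, so the common periods `L` have finite index in
the lattice of `S`. Hence `S` modulo `L` is finite, `g` descends to a bijection onto `Q` modulo `L`,
and both isosets are class frequencies over these quotients (`isoset_eq_card_div_card`). Pairing
points along `g` gives a flow all of whose costs are at most `2δ`. -/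

open scoped NNReal ENNReal Pointwise

noncomputable section

/-! ### Couplings and the Earth Mover's Distance -/

section Transport

open Classical in
/-- A finite coupling of two weighted distributions all of whose pairs are at distance at most `c`
bounds the Earth Mover's Distance by `c`. -/
theorem earthMoverDist_le_of_coupling {X Y T : Type*} [Fintype T] [Nonempty T]
    (d : X → Y → ℝ≥0∞) (w : X →₀ ℝ≥0) (v : Y →₀ ℝ≥0) (a : T → X) (b : T → Y) (c : ℝ≥0∞)
    (hw : ∀ x, w x = ((Finset.univ.filter fun t => a t = x).card : ℝ≥0) / Fintype.card T)
    (hv : ∀ y, v y = ((Finset.univ.filter fun t => b t = y).card : ℝ≥0) / Fintype.card T)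
    (hd : ∀ t, d (a t) (b t) ≤ c) :
    earthMoverDist d w v ≤ c := by
  have hT : (Fintype.card T : ℝ≥0) ≠ 0 := Nat.cast_ne_zero.2 Fintype.card_ne_zero
  have ha : ∀ t, a t ∈ w.support := fun t => by
    rw [Finsupp.mem_support_iff, hw]
    exact div_ne_zero (Nat.cast_ne_zero.2 (Finset.card_ne_zero_of_mem
      (Finset.mem_filter.2 ⟨Finset.mem_univ t, rfl⟩))) hT
  have hb : ∀ t, b t ∈ v.support := fun t => by
    rw [Finsupp.mem_support_iff, hv]
    exact div_ne_zero (Nat.cast_ne_zero.2 (Finset.card_ne_zero_of_mem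
      (Finset.mem_filter.2 ⟨Finset.mem_univ t, rfl⟩))) hT
  let a' : T → w.support := fun t => ⟨a t, ha t⟩
  let b' : T → v.support := fun t => ⟨b t, hb t⟩
  let f : w.support → v.support → ℝ≥0 := fun i j =>
    ((Finset.univ.filter fun t => a' t = i ∧ b' t = j).card : ℝ≥0) / Fintype.card T
  have hrow : ∀ i, ∑ j, f i j = w i := by
    intro i
    rw [hw, ← Finset.sum_div, ← Nat.cast_sum]
    congr 2
    rw [Finset.card_eq_sum_card_fiberwise (f := b') (t := Finset.univ)
      (fun _ _ => Finset.mem_coe.2 (Finset.mem_univ _))]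
    refine Finset.sum_congr rfl fun j _ => ?_
    rw [Finset.filter_filter]
    exact congrArg Finset.card (Finset.filter_congr fun t _ => by rw [Subtype.ext_iff])
  have hcol : ∀ j, ∑ i, f i j = v j := by
    intro j
    rw [hv, ← Finset.sum_div, ← Nat.cast_sum]
    congr 2
    rw [Finset.card_eq_sum_card_fiberwise (f := a') (t := Finset.univ)
      (fun _ _ => Finset.mem_coe.2 (Finset.mem_univ _))]
    refine Finset.sum_congr rfl fun i _ => ?_
    rw [Finset.filter_filter]
    exact congrArg Finset.card (Finset.filter_congr fun t _ => by
      rw [Subtype.ext_iff (a2 := j), and_comm])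
  have htot : ∑ i, ∑ j, f i j = 1 := by
    have : ∀ i : w.support, ∑ j, f i j =
        ((Finset.univ.filter fun t => a' t = i).card : ℝ≥0) / Fintype.card T := fun i => by
      rw [hrow, hw]
      simp [a', Subtype.ext_iff]
    rw [Finset.sum_congr rfl fun i _ => this i, ← Finset.sum_div, ← Nat.cast_sum,
      ← Finset.card_eq_sum_card_fiberwise (fun _ _ => Finset.mem_coe.2 (Finset.mem_univ _)),
      Finset.card_univ, div_self hT]
  have hflow : IsFlow w v f := by
    refine ⟨fun i j => ?_, fun i => (hrow i).le, fun j => (hcol j).le, htot⟩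
    exact div_le_one_of_le₀ (Nat.cast_le.2 (Finset.card_le_univ _)) zero_le
  refine (iInf₂_le f hflow).trans ?_
  calc ∑ i, ∑ j, (f i j : ℝ≥0∞) * d (i : X) (j : Y)
      ≤ ∑ i, ∑ j, (f i j : ℝ≥0∞) * c := by
        refine Finset.sum_le_sum fun i _ => Finset.sum_le_sum fun j _ => ?_
        -- Only pairs hit by some index carry mass; elsewhere `d` may even be infinite, as `0 * ∞ =
        -- 0`.
        by_cases h : f i j = 0
        · simp [h]
        · have hc : (Finset.univ.filter fun t => a' t = i ∧ b' t = j).card ≠ 0 := fun h0 =>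
            h (by simp only [f, h0, Nat.cast_zero, zero_div])
          obtain ⟨t, ht⟩ := Finset.card_ne_zero.1 hc
          obtain ⟨-, rfl, rfl⟩ := Finset.mem_filter.1 ht
          exact mul_le_mul_right (hd t) _
    _ = ((∑ i, ∑ j, f i j : ℝ≥0) : ℝ≥0∞) * c := by
        push_cast
        simp_rw [Finset.sum_mul]
    _ = c := by rw [htot]; simp

open Classical in
/-- A map with fibres of constant size over `s` preserves the proportions of subsets. -/
theorem card_filter_div_card_of_fiber_card {T M Z : Type*} [Fintype T] (s : Finset M) (a : T → M)
    (ha : ∀ t, a t ∈ s) (K : ℕ) (hK0 : K ≠ 0)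
    (hK : ∀ m ∈ s, (Finset.univ.filter fun t => a t = m).card = K) (φ : M → Z) (z : Z) :
    ((Finset.univ.filter fun t => φ (a t) = z).card : ℝ≥0) / Fintype.card T =
      ((s.filter fun m => φ m = z).card : ℝ≥0) / s.card := by
  have h1 : (Finset.univ.filter fun t => φ (a t) = z).card =
      (s.filter fun m => φ m = z).card * K := by
    rw [Finset.card_eq_sum_card_fiberwise (f := a) (t := s.filter fun m => φ m = z)]
    · rw [← smul_eq_mul, ← Finset.sum_const]
      refine Finset.sum_congr rfl fun m hm => ?_
      obtain ⟨hms, rfl⟩ := Finset.mem_filter.1 hm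
      rw [← hK m hms, Finset.filter_filter]
      congr 1
      ext t
      simp only [Finset.mem_filter, Finset.mem_univ, true_and, and_iff_right_iff_imp]
      rintro rfl
      rfl
    · intro t ht
      simp only [Finset.coe_filter, Finset.mem_univ, true_and, Set.mem_ofPred_eq] at ht ⊢
      exact ⟨ha t, ht⟩
  have h2 : Fintype.card T = s.card * K := by
    rw [← Finset.card_univ, Finset.card_eq_sum_card_fiberwise (f := a) (t := s)
      (fun t _ => ha t), Finset.sum_congr rfl hK, Finset.sum_const, smul_eq_mul]
  rw [h1, h2]
  push_cast
  exact mul_div_mul_right _ _ (Nat.cast_ne_zero.2 hK0)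

end Transport

/-! ### Isosets computed modulo a group of periods -/

namespace PeriodicPointSet

variable {n : ℕ}

/-- The lattice of a periodic point set as an additive subgroup. -/
def latticeSubgroup (S : PeriodicPointSet n) : AddSubgroup (Euc n) :=
  (Submodule.span ℤ (Set.range S.basis)).toAddSubgroup

theorem mem_points_iff_fract (S : PeriodicPointSet n) (x : Euc n) :
    x ∈ S.points ↔ ZSpan.fract S.basis x ∈ S.motif := by
  constructor
  · rintro ⟨m, hm, l, hl, rfl⟩
    simp only
    rw [ZSpan.fract_add_ZSpan S.basis m hl, ZSpan.fract_eq_self.2 (S.motif_subset hm)]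
    exact hm
  · intro h
    refine ⟨_, h, ZSpan.floor S.basis x, (ZSpan.floor S.basis x).2, ?_⟩
    simp [ZSpan.fract_apply]

theorem add_mem_points (S : PeriodicPointSet n) {x l : Euc n} (hl : l ∈ S.latticeSubgroup) :
    x + l ∈ S.points ↔ x ∈ S.points := by
  rw [mem_points_iff_fract, mem_points_iff_fract, ZSpan.fract_add_ZSpan S.basis x hl]

theorem localCluster_add (S : PeriodicPointSet n) (x : Euc n) {l : Euc n}
    (hl : l ∈ S.latticeSubgroup) (α : ℝ) :
    localCluster S.points (x + l) α = localCluster S.points x α := by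
  ext v
  constructor
  · rintro ⟨q, hq, rfl, h⟩
    refine ⟨q - l, ?_, by abel, by rwa [sub_sub, add_comm l]⟩
    rw [sub_eq_add_neg]
    exact (S.add_mem_points (neg_mem hl)).2 hq
  · rintro ⟨q, hq, rfl, h⟩
    refine ⟨q + l, (S.add_mem_points hl).2 hq, by abel, by rwa [add_sub_add_right_eq_sub]⟩

theorem localCluster_fract (S : PeriodicPointSet n) (x : Euc n) (α : ℝ) :
    localCluster S.points (ZSpan.fract S.basis x) α = localCluster S.points x α := by
  rw [ZSpan.fract_apply, sub_eq_add_neg]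
  exact S.localCluster_add x (neg_mem (ZSpan.floor S.basis x).2) α

/-- The points of a periodic point set modulo a subgroup. -/
def pointsMod (S : PeriodicPointSet n) (L : AddSubgroup (Euc n)) : Set (Euc n ⧸ L) :=
  (QuotientAddGroup.mk : Euc n → Euc n ⧸ L) '' S.points

theorem mk_mem_pointsMod (S : PeriodicPointSet n) {L : AddSubgroup (Euc n)}
    (hL : L ≤ S.latticeSubgroup) {x : Euc n} :
    (x : Euc n ⧸ L) ∈ S.pointsMod L ↔ x ∈ S.points := by
  refine ⟨?_, fun h => ⟨x, h, rfl⟩⟩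
  rintro ⟨y, hy, h⟩
  rw [QuotientAddGroup.eq] at h
  have := (S.add_mem_points (hL h)).2 hy
  rwa [add_neg_cancel_left] at this

theorem out_mem_points (S : PeriodicPointSet n) {L : AddSubgroup (Euc n)}
    (hL : L ≤ S.latticeSubgroup) (t : S.pointsMod L) : (t : Euc n ⧸ L).out ∈ S.points := by
  rw [← S.mk_mem_pointsMod hL, QuotientAddGroup.out_eq']
  exact t.2

-- Reduction to the unit cell maps the quotient onto the motif, and each fibre is a copy of the
-- lattice modulo `L`. Equal fibre sizes leave the frequencies unchanged.
open Classical in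
theorem isoset_eq_card_div_card (S : PeriodicPointSet n) {L : AddSubgroup (Euc n)}
    (hL : L ≤ S.latticeSubgroup) [Fintype (S.pointsMod L)] (α : ℝ) (σ : ClusterClass n) :
    S.isoset α σ = ((Finset.univ.filter fun t : S.pointsMod L =>
      ClusterClass.mk (localCluster S.points (t : Euc n ⧸ L).out α) = σ).card : ℝ≥0) /
        Fintype.card (S.pointsMod L) := by
  let a : S.pointsMod L → Euc n := fun t => ZSpan.fract S.basis (t : Euc n ⧸ L).out
  have key : ∀ m ∈ S.motif, Nat.card {t // a t = m} =
      Nat.card (S.latticeSubgroup.map (QuotientAddGroup.mk' L)) := by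
    intro m hm
    have hfm : ZSpan.fract S.basis m = m := ZSpan.fract_eq_self.2 (S.motif_subset hm)
    have hmS : m ∈ S.points := by rwa [mem_points_iff_fract, hfm]
    have hmem : ∀ l ∈ S.latticeSubgroup.map (QuotientAddGroup.mk' L),
        (m : Euc n ⧸ L) + l ∈ S.pointsMod L := by
      rintro _ ⟨l, hl, rfl⟩
      exact ⟨m + l, (S.add_mem_points hl).2 hmS, rfl⟩
    have hfib : ∀ (l) (hl : l ∈ S.latticeSubgroup.map (QuotientAddGroup.mk' L)),
        a ⟨(m : Euc n ⧸ L) + l, hmem l hl⟩ = m := by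
      rintro _ ⟨l, hl, rfl⟩
      have h : -(m + l) + ((m + l : Euc n) : Euc n ⧸ L).out ∈ L := by
        rw [← QuotientAddGroup.eq, QuotientAddGroup.out_eq']
      have h' := S.latticeSubgroup.add_mem hl (hL h)
      refine Eq.trans ?_ hfm
      refine ((ZSpan.fract_eq_fract S.basis _ _).2 ?_).symm
      refine (congrArg (· ∈ S.latticeSubgroup) ?_).mp h'
      change l + (-(m + l) + ((m + l : Euc n) : Euc n ⧸ L).out) =
        -m + ((m + l : Euc n) : Euc n ⧸ L).out
      abel
    refine (Nat.card_congr (Equiv.ofBijective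
      (fun l => ⟨⟨(m : Euc n ⧸ L) + l, hmem l l.2⟩, hfib l l.2⟩) ⟨?_, ?_⟩)).symm
    · intro l l' h
      exact Subtype.ext (add_left_cancel (congrArg (fun t => ((t.1 : S.pointsMod L) : Euc n ⧸ L)) h))
    · rintro ⟨t, ht⟩
      have h := (ZSpan.fract_eq_fract S.basis m _).1 (hfm.trans ht.symm)
      refine ⟨⟨_, _, h, rfl⟩, Subtype.ext (Subtype.ext ?_)⟩
      change (m : Euc n ⧸ L) + ((-m + (t : Euc n ⧸ L).out : Euc n) : Euc n ⧸ L) = t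
      rw [← QuotientAddGroup.mk_add, add_neg_cancel_left, QuotientAddGroup.out_eq']
  have hcard : ∀ m, (Finset.univ.filter fun t => a t = m).card = Nat.card {t // a t = m} :=
    fun m => by rw [Nat.card_eq_fintype_card, Fintype.card_subtype]
  have haM : ∀ t, a t ∈ S.motif := fun t =>
    (S.mem_points_iff_fract _).1 (S.out_mem_points hL t)
  have h := card_filter_div_card_of_fiber_card S.motif a haM
    (Nat.card (S.latticeSubgroup.map (QuotientAddGroup.mk' L))) ?_
    (fun m hm => by convert (hcard m).trans (key m hm))
    (fun x => ClusterClass.mk (localCluster S.points x α)) σ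
  · simp only [a, S.localCluster_fract] at h
    exact h.symm
  · obtain ⟨m, hm⟩ := S.motif_nonempty
    have hmS : m ∈ S.points := by
      rwa [mem_points_iff_fract, ZSpan.fract_eq_self.2 (S.motif_subset hm)]
    have t : S.pointsMod L := ⟨(m : Euc n ⧸ L), m, hmS, rfl⟩
    rw [← key (a t) (haM t)]
    have : Nonempty {s // a s = a t} := ⟨⟨t, rfl⟩⟩
    exact Nat.card_pos.ne'

/-- The lattice modulo `L` is a finitely generated torsion abelian group, hence finite; finitely
many translates of it cover the quotient. -/
theorem finite_pointsMod (S : PeriodicPointSet n) {L : AddSubgroup (Euc n)}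
    (hL : ∀ v ∈ S.latticeSubgroup, ∃ k : ℕ, 0 < k ∧ k • v ∈ L) : (S.pointsMod L).Finite := by
  have hfg : AddSubgroup.FG S.latticeSubgroup := by
    rw [latticeSubgroup, ← Submodule.fg_iff_addSubgroup_fg]
    exact Submodule.fg_span (Set.finite_range _)
  have hfin : Finite (S.latticeSubgroup.map (QuotientAddGroup.mk' L)) := by
    have : AddGroup.FG (S.latticeSubgroup.map (QuotientAddGroup.mk' L)) := by
      have := (AddGroup.fg_iff_addSubgroup_fg _).2 hfg
      exact AddGroup.fg_of_surjective
        ((QuotientAddGroup.mk' L).addSubgroupMap_surjective S.latticeSubgroup)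
    refine AddCommGroup.finite_of_fg_isAddTorsion _ ?_
    rintro ⟨_, v, hv, rfl⟩
    obtain ⟨k, hk, hkv⟩ := hL v hv
    refine isOfFinAddOrder_iff_nsmul_eq_zero.2 ⟨k, hk, Subtype.ext ?_⟩
    simpa using (QuotientAddGroup.eq_zero_iff (k • v)).2 hkv
  have : S.pointsMod L ⊆ ((fun x : Euc n => (x : Euc n ⧸ L)) '' (S.motif : Set (Euc n))) +
      (S.latticeSubgroup.map (QuotientAddGroup.mk' L) : Set (Euc n ⧸ L)) := by
    rintro _ ⟨_, ⟨m, hm, l, hl, rfl⟩, rfl⟩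
    exact ⟨_, ⟨m, hm, rfl⟩, _, ⟨l, hl, rfl⟩, rfl⟩
  exact ((S.motif.finite_toSet.image _).add (Set.toFinite _)).subset this

/-- Simultaneous approximation: some positive multiple of any vector is close to the lattice. -/
theorem exists_nsmul_near_lattice (Q : PeriodicPointSet n) (v : Euc n) {η : ℝ} (hη : 0 < η) :
    ∃ k : ℕ, 0 < k ∧ ∃ l ∈ Q.latticeSubgroup, ‖k • v - l‖ < η := by
  -- Bolzano–Weierstrass in the bounded unit cell: two multiples of `v` have close fractional parts,
  -- and their difference is the required multiple.
  obtain ⟨a, -, φ, hφ, hlim⟩ := tendsto_subseq_of_bounded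
    (ZSpan.fundamentalDomain_isBounded Q.basis) (x := fun k : ℕ => ZSpan.fract Q.basis (k • v))
    (fun k => ZSpan.fract_mem_fundamentalDomain Q.basis _)
  obtain ⟨N, hN⟩ := Metric.cauchySeq_iff'.1 hlim.cauchySeq η hη
  have h := hN (N + 1) N.le_succ
  have hlt : φ N < φ (N + 1) := hφ N.lt_succ_self
  refine ⟨φ (N + 1) - φ N, Nat.sub_pos_of_lt hlt,
    (ZSpan.floor Q.basis (φ (N + 1) • v) : Euc n) - ZSpan.floor Q.basis (φ N • v),
    sub_mem (ZSpan.floor Q.basis _).2 (ZSpan.floor Q.basis _).2, ?_⟩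
  have heq : (φ (N + 1) - φ N) • v - ((ZSpan.floor Q.basis (φ (N + 1) • v) : Euc n) -
      ZSpan.floor Q.basis (φ N • v)) =
      ZSpan.fract Q.basis (φ (N + 1) • v) - ZSpan.fract Q.basis (φ N • v) := by
    rw [ZSpan.fract_apply, ZSpan.fract_apply, sub_nsmul _ hlt.le]
    abel
  rw [heq, ← dist_eq_norm]
  exact h

/-! ### Rigidity of bijections with small displacement -/

section Bijection

variable {S Q : PeriodicPointSet n} (g : S.points ≃ Q.points) {δ η : ℝ}

/-- Both sides lie in `Q`, and two displacements plus the error `η` are too short to separate them.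
-/
theorem apply_add_eq_of_near (hg : ∀ p, dist (g p : Euc n) p ≤ δ)
    (hsep : ∀ x ∈ Q.points, ∀ y ∈ Q.points, dist x y ≤ 2 * δ + η → x = y)
    (p p' : S.points) {l : Euc n} (hl : l ∈ Q.latticeSubgroup)
    (h : ‖(p' : Euc n) - p - l‖ ≤ η) : (g p' : Euc n) = g p + l := by
  refine hsep _ (g p').2 _ ((Q.add_mem_points hl).2 (g p).2) ?_
  have h1 := hg p'
  have h2 := hg p
  rw [dist_eq_norm] at *
  calc ‖(g p' : Euc n) - (g p + l)‖
      = ‖((g p' : Euc n) - p') - ((g p : Euc n) - p) + ((p' : Euc n) - p - l)‖ := by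
        congr 1
        abel
    _ ≤ ‖((g p' : Euc n) - p')‖ + ‖(g p : Euc n) - p‖ + ‖(p' : Euc n) - p - l‖ :=
        (norm_add_le _ _).trans (add_le_add_left (norm_sub_le _ _) _)
    _ ≤ 2 * δ + η := by linarith

theorem eq_of_near_lattice (hg : ∀ p, dist (g p : Euc n) p ≤ δ)
    (hsep : ∀ x ∈ Q.points, ∀ y ∈ Q.points, dist x y ≤ 2 * δ + η → x = y)
    {w l : Euc n} (hw : w ∈ S.latticeSubgroup) (hl : l ∈ Q.latticeSubgroup)
    (h : ‖w - l‖ ≤ η) : w = l := by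
  obtain ⟨m, hm⟩ := S.motif_nonempty
  have hmS : m ∈ S.points := by
    rwa [mem_points_iff_fract, ZSpan.fract_eq_self.2 (S.motif_subset hm)]
  let p : ℕ → S.points := fun j => ⟨m + j • w, (S.add_mem_points (nsmul_mem hw j)).2 hmS⟩
  have key : ∀ j : ℕ, (g (p j) : Euc n) = g (p 0) + j • l := by
    intro j
    induction j with
    | zero => simp
    | succ j ih =>
      rw [apply_add_eq_of_near g hg hsep (p j) (p (j + 1)) hl, ih, succ_nsmul, add_assoc]
      convert h using 2
      simp only [p, succ_nsmul]
      abel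
  -- After `j` shifts the displacement vector has drifted by exactly `j • (l - w)`, yet it stays
  -- within `δ`.
  have hb : ∀ j : ℕ, j * ‖w - l‖ ≤ 2 * δ := by
    intro j
    have h1 := hg (p j)
    have h2 := hg (p 0)
    rw [dist_eq_norm] at h1 h2
    calc j * ‖w - l‖ = ‖((g (p 0) : Euc n) - p 0) - ((g (p j) : Euc n) - p j)‖ := by
          rw [← nsmul_eq_mul, ← RCLike.norm_nsmul ℝ, key j, nsmul_sub]
          congr 1
          simp only [p, zero_nsmul]
          abel
      _ ≤ 2 * δ := (norm_sub_le _ _).trans (by linarith)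
  by_contra hne
  have hpos : 0 < ‖w - l‖ := norm_pos_iff.2 (sub_ne_zero.2 hne)
  obtain ⟨j, hj⟩ := exists_nat_gt (2 * δ / ‖w - l‖)
  rw [div_lt_iff₀ hpos] at hj
  exact absurd (hb j) hj.not_ge

theorem exists_nsmul_mem_inf (hη : 0 < η) (hg : ∀ p, dist (g p : Euc n) p ≤ δ)
    (hsep : ∀ x ∈ Q.points, ∀ y ∈ Q.points, dist x y ≤ 2 * δ + η → x = y)
    {v : Euc n} (hv : v ∈ S.latticeSubgroup) :
    ∃ k : ℕ, 0 < k ∧ k • v ∈ S.latticeSubgroup ⊓ Q.latticeSubgroup := by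
  obtain ⟨k, hk, l, hl, h⟩ := Q.exists_nsmul_near_lattice v hη
  have hw := nsmul_mem hv k
  refine ⟨k, hk, hw, ?_⟩
  rwa [eq_of_near_lattice g hg hsep hw hl h.le]

/-- A bijection of small displacement induces a bijection of points modulo common periods. -/
theorem exists_pointsMod_equiv (hη : 0 < η) (hg : ∀ p, dist (g p : Euc n) p ≤ δ)
    (hsep : ∀ x ∈ Q.points, ∀ y ∈ Q.points, dist x y ≤ 2 * δ + η → x = y)
    {L : AddSubgroup (Euc n)} (hS : L ≤ S.latticeSubgroup) (hQ : L ≤ Q.latticeSubgroup) :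
    ∃ e : S.pointsMod L ≃ Q.pointsMod L, ∀ t,
      (e t : Euc n ⧸ L) = ((g ⟨(t : Euc n ⧸ L).out, S.out_mem_points hS t⟩ : Euc n) : Euc n ⧸ L) := by
  -- With zero error, `g` commutes with common periods, so it descends to the quotients.
  have hadd : ∀ p p' : S.points, (p' : Euc n) - p ∈ L → (g p' : Euc n) = g p + (p' - p) :=
    fun p p' h => apply_add_eq_of_near g hg hsep p p' (hQ h) (by simpa using hη.le)
  refine ⟨Equiv.ofBijective (fun t => ⟨_, (g ⟨_, S.out_mem_points hS t⟩ : Euc n),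
    (g ⟨_, S.out_mem_points hS t⟩).2, rfl⟩) ⟨?_, ?_⟩, fun t => rfl⟩
  · intro t t' h
    have h := QuotientAddGroup.eq.1 (congrArg Subtype.val h)
    have hmem := (S.add_mem_points (hS h)).2 (S.out_mem_points hS t)
    have h1 := hadd ⟨_, S.out_mem_points hS t⟩ ⟨_, hmem⟩ (by rwa [add_sub_cancel_left])
    simp only [add_sub_cancel_left] at h1
    rw [add_neg_cancel_left] at h1
    have h2 : (t : Euc n ⧸ L).out + (-(g ⟨_, S.out_mem_points hS t⟩ : Euc n) +
        g ⟨_, S.out_mem_points hS t'⟩) = (t' : Euc n ⧸ L).out :=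
      congrArg Subtype.val (g.injective (Subtype.ext h1))
    apply Subtype.ext
    rw [← QuotientAddGroup.out_eq' (t : Euc n ⧸ L), ← QuotientAddGroup.out_eq' (t' : Euc n ⧸ L),
      QuotientAddGroup.eq, ← h2, neg_add_cancel_left]
    exact h
  · rintro ⟨_, q, hq, rfl⟩
    obtain ⟨p, hp⟩ := g.surjective ⟨q, hq⟩
    let t : S.pointsMod L := ⟨((p : Euc n) : Euc n ⧸ L), p, p.2, rfl⟩
    have h : -((p : Euc n) : Euc n ⧸ L).out + (p : Euc n) ∈ L := by
      rw [← QuotientAddGroup.eq, QuotientAddGroup.out_eq']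
    have h1 := hadd ⟨_, S.out_mem_points hS t⟩ p (by rwa [sub_eq_neg_add])
    refine ⟨t, Subtype.ext (QuotientAddGroup.eq.2 ?_)⟩
    have hq' : q = g p := by rw [hp]
    rw [hq', h1, neg_add_cancel_left, sub_eq_neg_add]
    exact h

end Bijection

/-! ### Cluster comparison and the final bound -/

/-- The identity isometry suffices: centre and neighbour each move by at most `δ`, so difference
vectors change by at most `2δ`. Cutting at `α - 2δ` keeps the matched vector within `α`. -/
theorem coversUpTo_of_exists_near {A B : Set (Euc n)} {p q : Euc n} {δ : ℝ≥0} (α : ℝ)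
    (hpq : dist q p ≤ δ) (h : ∀ q' ∈ B, ∃ p' ∈ A, dist q' p' ≤ δ) :
    CoversUpTo α (localCluster A p α) (localCluster B q α) (2 * δ) := by
  refine ⟨IsometryEquiv.refl _, rfl, ?_⟩
  rintro _ ⟨⟨q', hq', rfl, -⟩, hn⟩
  obtain ⟨p', hp', hd⟩ := h q' hq'
  rw [dist_eq_norm] at hpq hd
  have hdiff : ‖(q' - p') - (q - p)‖ ≤ 2 * δ := (norm_sub_le _ _).trans (by linarith)
  push_cast at hn
  refine ⟨p' - p, ⟨p' - p, ⟨p', hp', rfl, ?_⟩, rfl⟩, (q' - p') - (q - p), ?_, by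
    simp only; abel⟩
  · calc ‖p' - p‖ = ‖(q' - q) - ((q' - p') - (q - p))‖ := by congr 1; abel
      _ ≤ α := (norm_sub_le _ _).trans (by linarith)
  · rw [mem_closedBall_zero_iff]
    push_cast
    exact hdiff

theorem boundaryTolerant_le_of_near {S Q : PeriodicPointSet n} (g : S.points ≃ Q.points) {δ : ℝ≥0}
    (hg : ∀ p, dist (g p : Euc n) p ≤ δ) (α : ℝ) (p : S.points) :
    boundaryTolerant α (ClusterClass.mk (localCluster S.points p α))
      (ClusterClass.mk (localCluster Q.points (g p) α)) ≤ 2 * δ := by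
  have h : clusterBT α (localCluster S.points p α) (localCluster Q.points (g p) α) ≤
      ((2 * δ : ℝ≥0) : ℝ≥0∞) := by
    refine iInf₂_le (2 * δ) ⟨coversUpTo_of_exists_near α (hg p) fun q hq => ?_,
      coversUpTo_of_exists_near α (by rw [dist_comm]; exact hg p) fun q hq => ?_⟩
    · refine ⟨_, (g.symm ⟨q, hq⟩).2, ?_⟩
      simpa using hg (g.symm ⟨q, hq⟩)
    · exact ⟨_, (g ⟨q, hq⟩).2, by rw [dist_comm]; exact hg ⟨q, hq⟩⟩
  exact_mod_cast (show boundaryTolerant α _ _ ≤ _ from h)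

theorem earthMoverDist_isoset_le_of_bijection {S Q : PeriodicPointSet n}
    (g : S.points ≃ Q.points) {δ : ℝ≥0} {η : ℝ} (hη : 0 < η)
    (hg : ∀ p, dist (g p : Euc n) p ≤ δ)
    (hsep : ∀ x ∈ Q.points, ∀ y ∈ Q.points, dist x y ≤ 2 * δ + η → x = y) (α : ℝ) :
    earthMoverDist (boundaryTolerant α) (S.isoset α) (Q.isoset α) ≤ 2 * δ := by
  classical
  let L := S.latticeSubgroup ⊓ Q.latticeSubgroup
  have hS : L ≤ S.latticeSubgroup := inf_le_left
  have hQ : L ≤ Q.latticeSubgroup := inf_le_right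
  obtain ⟨e, he⟩ := exists_pointsMod_equiv g hη hg hsep hS hQ
  have : Fintype (S.pointsMod L) :=
    (S.finite_pointsMod fun v hv => exists_nsmul_mem_inf g hη hg hsep hv).fintype
  have : Fintype (Q.pointsMod L) := Fintype.ofEquiv _ e
  obtain ⟨m, hm⟩ := S.motif_nonempty
  have : Nonempty (S.pointsMod L) := by
    refine ⟨⟨_, m, ?_, rfl⟩⟩
    rwa [mem_points_iff_fract, ZSpan.fract_eq_self.2 (S.motif_subset hm)]
  refine earthMoverDist_le_of_coupling _ _ _
    (fun t : S.pointsMod L => ClusterClass.mk (localCluster S.points (t : Euc n ⧸ L).out α))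
    (fun t => ClusterClass.mk
      (localCluster Q.points (g ⟨(t : Euc n ⧸ L).out, S.out_mem_points hS t⟩) α)) _
    (S.isoset_eq_card_div_card hS α) ?_
    (fun t => boundaryTolerant_le_of_near g hg α ⟨_, S.out_mem_points hS t⟩)
  intro ξ
  rw [Q.isoset_eq_card_div_card hQ α, Fintype.card_congr e]
  congr 2
  refine (Finset.card_equiv e fun t => ?_).symm
  simp only [Finset.mem_filter, Finset.mem_univ, true_and]
  -- The chosen representative of `e t` may differ from the image under `g`, but only by a period of
  -- `Q`, which preserves clusters.
  have h : -(g ⟨_, S.out_mem_points hS t⟩ : Euc n) + (e t : Euc n ⧸ L).out ∈ L := by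
    rw [← QuotientAddGroup.eq, QuotientAddGroup.out_eq', he]
  have h' := Q.localCluster_add (g ⟨_, S.out_mem_points hS t⟩) (hQ h) α
  rw [add_neg_cancel_left] at h'
  rw [h']

end PeriodicPointSet

theorem exists_separation_of_lt_packingRadius {X : Type*} [PseudoMetricSpace X] {A : Set X}
    {δ : ℝ≥0} (h : (δ : ℝ≥0∞) < packingRadius A) :
    ∃ η : ℝ, 0 < η ∧ ∀ x ∈ A, ∀ y ∈ A, dist x y ≤ 2 * δ + η → x = y := by
  obtain ⟨ρ, hδ, hρ⟩ := ENNReal.lt_iff_exists_nnreal_btwn.1 h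
  have hδ : δ < ρ := ENNReal.coe_lt_coe.1 hδ
  -- This makes `2δ + η = 2ρ`, strictly below the minimal separation.
  refine ⟨2 * (ρ - δ), by simpa using hδ, fun x hx y hy hxy => ?_⟩
  by_contra hne
  have h1 := Set.einfsep_le_edist_of_mem hx hy hne
  have h2 : (ρ : ℝ≥0∞) * 2 < A.einfsep :=
    (ENNReal.lt_div_iff_mul_lt (Or.inl two_ne_zero) (Or.inl ENNReal.ofNat_ne_top)).1 hρ
  have h3 := h2.trans_le h1
  rw [edist_nndist] at h3
  have h4 : (ρ : ℝ) * 2 < dist x y := by exact_mod_cast h3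
  linarith

end

theorem mainTheorem6 (n : ℕ) (S Q : PeriodicPointSet n)
    (hBD : bottleneckDist S.points Q.points < packingRadius Q.points)
    (α : ℝ) (hα : 0 ≤ α) :
    earthMoverDist (boundaryTolerant α) (S.isoset α) (Q.isoset α) ≤
      2 * bottleneckDist S.points Q.points := by
  rw [mul_comm, ← ENNReal.div_le_iff_le_mul (Or.inl two_ne_zero) (Or.inl ENNReal.ofNat_ne_top)]
  refine le_of_forall_gt fun c hc => ?_
  -- The infimum need not be attained; one bijection must beat both `c` and the packing radius.
  obtain ⟨g, hg⟩ := iInf_lt_iff.1 (lt_min hc hBD)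
  obtain ⟨hgc, hgr⟩ := lt_min_iff.1 hg
  lift (⨆ p : S.points, edist ((g p : Q.points) : Euc n) (p : Euc n)) to ℝ≥0 using hgr.ne_top
    with δ hδ
  have hdist : ∀ p, dist (g p : Euc n) p ≤ δ := fun p => by
    have h := le_iSup (fun p : S.points => edist ((g p : Q.points) : Euc n) (p : Euc n)) p
    rw [← hδ, edist_nndist] at h
    exact_mod_cast h
  obtain ⟨η, hη, hsep⟩ := exists_separation_of_lt_packingRadius hgr
  refine lt_of_le_of_lt ?_ hgc
  rw [ENNReal.div_le_iff_le_mul (Or.inl two_ne_zero) (Or.inl ENNReal.ofNat_ne_top), mul_comm]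
  exact PeriodicPointSet.earthMoverDist_isoset_le_of_bijection g hη hdist hsep α
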